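/- For a group $G$ let $\widehat{G}$ be its profinite completion, with canonical homomorphism $\eta_G\colon G\to\widehat{G}$. Let $\operatorname{Aut}\widehat{G}$ be the group of continuous automorphisms of $\widehat{G}$ under composition, with the topology of uniform convergence. By functoriality every $\sigma\in\operatorname{Aut}G$ induces $\widehat{\sigma}\in\operatorname{Aut}\widehat{G}$, characterized by $\widehat{\sigma}\circ\eta_G=\eta_G\circ\sigma$. Let $F$ be the free group on $x,y$, let $\Phi$ be the free group on $a,b$, and let $\rho\colon\Phi\to\operatorname{Aut}F$ be the homomorphism with $\rho(a)=\alpha$ and $\rho(b)=\beta$, where $\alpha,\beta\in\operatorname{Aut}F$ are given by $$\alpha\colon x\mapsto x,\ y\mapsto yx^2,\qquad \beta\colon x\mapsto xy^2,\ y\mapsto y.$$ **Proposition 3.3.** There is a unique continuous homomorphism $\nu\colon\widehat{\Phi}\to\operatorname{Aut}\widehat{F}$ such that $\nu(\eta_\Phi(g))=\widehat{\rho(g)}$ for all $g\in\Phi$, and $\nu$ is injective. -/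

import Mathlib

noncomputable section

open CategoryTheory

universe u

namespace ProfAut

/-! ## Continuous automorphisms of a topological group -/

/-- The continuous automorphisms of a topological group (automorphisms that are
homeomorphisms). -/
abbrev ContAut (G : Type u) [Group G] [TopologicalSpace G] : Type u := G ≃ₜ* G

/-- The product of two automorphisms is their composition, `(f * g) x = f (g x)`. -/
instance instGroupContAut (G : Type u) [Group G] [TopologicalSpace G] : Group (ContAut G) where
  mul f g := g.trans f
  one := ContinuousMulEquiv.refl G
  inv f := f.symm
  mul_assoc _ _ _ := rfl
  one_mul _ := rfl
  mul_one _ := rfl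
  inv_mul_cancel f := ContinuousMulEquiv.ext f.symm_apply_apply

/-- The underlying continuous map of a continuous automorphism. -/
def ContAut.toCMap {G : Type u} [Group G] [TopologicalSpace G] (f : ContAut G) : C(G, G) :=
  ⟨f, f.continuous_toFun⟩

/-- The compact-open topology. For compact `G` (the only case used) this is the topology of
uniform convergence, and for a finitely generated profinite `G` it is the profinite topology of
the projective limit of the `Aut (G / U)` over the open characteristic subgroups `U`. -/
instance instTopologicalSpaceContAut (G : Type u) [Group G] [TopologicalSpace G] :
    TopologicalSpace (ContAut G) :=
  TopologicalSpace.induced ContAut.toCMap ContinuousMap.compactOpen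

theorem ContAut.mul_apply {G : Type u} [Group G] [TopologicalSpace G] (f g : ContAut G) (x : G) :
    (f * g) x = f (g x) := rfl

theorem ContAut.one_apply {G : Type u} [Group G] [TopologicalSpace G] (x : G) :
    (1 : ContAut G) x = x := rfl

/-! ## Profinite completions -/

/-- The profinite completion of a (discrete) group, as a profinite group. -/
abbrev Completion (G : Type u) [Group G] : ProfiniteGrp.{u} :=
  ProfiniteGrp.profiniteCompletion.obj (GrpCat.of G)

/-- The canonical homomorphism from a group to its profinite completion. -/
def toCompletion (G : Type u) [Group G] : G →* Completion G :=
  (ProfiniteGrp.ProfiniteCompletion.eta (GrpCat.of G)).hom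

/-- The continuous endomorphism of the profinite completion induced, by functoriality, by an
endomorphism of the group. -/
def completionMap {G : Type u} [Group G] (f : G →* G) : Completion G →ₜ* Completion G :=
  (ProfiniteGrp.profiniteCompletion.map (GrpCat.ofHom f)).hom

theorem completionMap_toCompletion {G : Type u} [Group G] (f : G →* G) (g : G) :
    completionMap f (toCompletion G g) = toCompletion G (f g) :=
  ConcreteCategory.congr_hom (ProfiniteGrp.ProfiniteCompletion.lift_eta
    (GrpCat.ofHom f ≫ ProfiniteGrp.ProfiniteCompletion.eta (GrpCat.of G))) g

theorem completionMap_id_apply {G : Type u} [Group G] (x : Completion G) :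
    completionMap (MonoidHom.id G) x = x :=
  ConcreteCategory.congr_hom (ProfiniteGrp.profiniteCompletion.map_id (GrpCat.of G)) x

theorem completionMap_comp_apply {G : Type u} [Group G] (f h : G →* G) (x : Completion G) :
    completionMap (f.comp h) x = completionMap f (completionMap h x) :=
  ConcreteCategory.congr_hom
    (ProfiniteGrp.profiniteCompletion.map_comp (GrpCat.ofHom h) (GrpCat.ofHom f)) x

/-- The natural homomorphism from the automorphism group of a group to the group of continuous
automorphisms of its profinite completion. -/
def completionAut (G : Type u) [Group G] : MulAut G →* ContAut (Completion G) where
  toFun e :=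
    { toFun := completionMap e.toMonoidHom
      invFun := completionMap e.symm.toMonoidHom
      left_inv := fun x => by
        rw [← completionMap_comp_apply]
        convert completionMap_id_apply x using 2
        congr 1
        ext g
        exact e.symm_apply_apply g
      right_inv := fun x => by
        rw [← completionMap_comp_apply]
        convert completionMap_id_apply x using 2
        congr 1
        ext g
        exact e.apply_symm_apply g
      map_mul' := map_mul _
      continuous_toFun := (completionMap e.toMonoidHom).continuous_toFun
      continuous_invFun := (completionMap e.symm.toMonoidHom).continuous_toFun }
  map_one' := ContinuousMulEquiv.ext completionMap_id_apply
  map_mul' e₁ e₂ := ContinuousMulEquiv.ext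
    (completionMap_comp_apply e₁.toMonoidHom e₂.toMonoidHom)

theorem completionAut_toCompletion {G : Type u} [Group G] (e : MulAut G) (g : G) :
    completionAut G e (toCompletion G g) = toCompletion G (e g) :=
  completionMap_toCompletion e.toMonoidHom g

/-! ## The two automorphisms of the free group of rank two -/

/-- The free group of rank two, with basis `FreeGroup.of 0`, `FreeGroup.of 1`. -/
abbrev F₂ : Type := FreeGroup (Fin 2)

/-- The first basis element of the free group of rank two. -/
def x : F₂ := FreeGroup.of 0

/-- The second basis element of the free group of rank two. -/
def y : F₂ := FreeGroup.of 1

/-- The endomorphism of the free group with `x ↦ s`, `y ↦ t`. -/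
def endo (s t : F₂) : F₂ →* F₂ := FreeGroup.lift ![s, t]

theorem endo_x (s t : F₂) : endo s t x = s := by simp [endo, x]

theorem endo_y (s t : F₂) : endo s t y = t := by simp [endo, y]

theorem hom_ext {f g : F₂ →* F₂} (hx : f x = g x) (hy : f y = g y) : f = g := by
  apply FreeGroup.ext_hom
  intro i
  fin_cases i
  · exact hx
  · exact hy

/-- The automorphism `x ↦ x`, `y ↦ y * x ^ 2`. -/
def α : MulAut F₂ :=
  MonoidHom.toMulEquiv (endo x (y * x ^ 2)) (endo x (y * (x ^ 2)⁻¹))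
    (hom_ext (by simp [endo_x]) (by simp [endo_x, endo_y]))
    (hom_ext (by simp [endo_x]) (by simp [endo_x, endo_y]))

/-- The automorphism `x ↦ x * y ^ 2`, `y ↦ y`. -/
def β : MulAut F₂ :=
  MonoidHom.toMulEquiv (endo (x * y ^ 2) y) (endo (x * (y ^ 2)⁻¹) y)
    (hom_ext (by simp [endo_x, endo_y]) (by simp [endo_y]))
    (hom_ext (by simp [endo_x, endo_y]) (by simp [endo_y]))

theorem α_x : α x = x := by simp [α, endo_x]
theorem α_y : α y = y * x ^ 2 := by simp [α, endo_y]
theorem β_x : β x = x * y ^ 2 := by simp [β, endo_x]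
theorem β_y : β y = y := by simp [β, endo_y]

/-- The homomorphism `Φ → Aut F` with `a ↦ α`, `b ↦ β`, where `Φ` is the free group on
`a = FreeGroup.of 0` and `b = FreeGroup.of 1`. -/
def ρ : FreeGroup (Fin 2) →* MulAut F₂ := FreeGroup.lift ![α, β]

end ProfAut

end

/-! Work in the semidirect product F ⋊ Φ (`SemiProd`). Since F is finitely generated, F̂ embeds in
the completion of F ⋊ Φ (`completionInl_injective`). Conjugation by the image of Φ̂ preserves this
copy of F̂, and that action is ν. Uniqueness is density of Φ in Φ̂.

For injectivity, F has a monomial representation of degree four over Φ in which x² and y² are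
diagonal with entries a⁻¹ and b⁻¹ at the base point, and in which ρ(g) amounts to conjugation by a
diagonal matrix with entry g there (`monomialRep_ρ_comp`). It therefore extends to F ⋊ Φ, and an
element of Φ acting trivially must commute with a and b. With coefficients reduced to finite groups,
the same argument shows that the kernel of ν is central in Φ̂, and Φ̂ is centerless
(`exists_finite_quotient_center_le`). -/

noncomputable section
open CategoryTheory
universe u
namespace ProfAut

/-! ## Centralizers in wreath products -/

section Wreath

variable {Q : Type*} [Group Q]

/-- The wreath product of the group of order two and `Q`. -/
abbrev BinaryWreath (Q : Type*) [Group Q] : Type _ :=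
  (Q → Multiplicative (ZMod 2)) ⋊[mulAutArrow] Q

/-- The element of the wreath product with value the generator at `1`, lying over `u`. -/
def BinaryWreath.mark (u : Q) : BinaryWreath Q :=
  open scoped Classical in ⟨Pi.mulSingle 1 (Multiplicative.ofAdd 1), u⟩

/-- Multiply the coordinates of the commutation relation over the points of ⟨u⟩. If g lies over an
element outside ⟨u⟩, it moves the marked point off ⟨u⟩, so the generator of order two survives on
one side only. Translation by u⁻¹ merely permutes the other factors, and the generator would be
trivial. -/
theorem BinaryWreath.right_mem_zpowers_of_commute [Finite Q] {u : Q} {g : BinaryWreath Q}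
    (h : Commute g (mark u)) : g.right ∈ Subgroup.zpowers u := by
  classical
  by_contra hg
  have := Fintype.ofFinite (Subgroup.zpowers u)
  have key := congrArg SemidirectProduct.left h.eq
  simp only [SemidirectProduct.mul_left, mark] at key
  have hpt (s : Subgroup.zpowers u) : g.left s
      = (Pi.mulSingle 1 (Multiplicative.ofAdd 1) : Q → Multiplicative (ZMod 2)) s
        * g.left (u⁻¹ * s) := by
    have h1 := congrFun key s
    have h2 : (Pi.mulSingle 1 (Multiplicative.ofAdd 1) : Q → Multiplicative (ZMod 2))
        (g.right⁻¹ * s) = 1 := by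
      rw [Pi.mulSingle_eq_of_ne]
      intro h3
      exact hg (inv_mul_eq_one.mp h3 ▸ s.2)
    change g.left s * (Pi.mulSingle 1 (Multiplicative.ofAdd 1) : Q → Multiplicative (ZMod 2))
        (g.right⁻¹ * s) = _ * g.left (u⁻¹ * s) at h1
    rwa [h2, mul_one] at h1
  have hprod := Fintype.prod_congr _ _ hpt
  rw [Finset.prod_mul_distrib] at hprod
  have hshift : ∏ s : Subgroup.zpowers u, g.left (u⁻¹ * s)
      = ∏ s : Subgroup.zpowers u, g.left s :=
    Fintype.prod_equiv (Equiv.mulLeft (⟨u, Subgroup.mem_zpowers u⟩⁻¹ : Subgroup.zpowers u)) _ _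
      fun _ => rfl
  rw [hshift] at hprod
  replace hprod := right_eq_mul.mp hprod
  rw [Fintype.prod_eq_single 1] at hprod
  · simp at hprod
  · intro s hs
    rw [Pi.mulSingle_eq_of_ne]
    exact fun h => hs (Subtype.ext h)

end Wreath

/-- The homomorphism from the free group of rank two with prescribed values on the basis. -/
def lift₂ {G : Type*} [Group G] (s t : G) : FreeGroup (Fin 2) →* G := FreeGroup.lift ![s, t]

@[simp] theorem lift₂_of_zero {G : Type*} [Group G] (s t : G) :
    lift₂ s t (FreeGroup.of 0) = s := by simp [lift₂]

@[simp] theorem lift₂_of_one {G : Type*} [Group G] (s t : G) :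
    lift₂ s t (FreeGroup.of 1) = t := by simp [lift₂]

theorem freeGroup_hom_ext {G : Type*} [Group G] {f g : FreeGroup (Fin 2) →* G}
    (h0 : f (FreeGroup.of 0) = g (FreeGroup.of 0)) (h1 : f (FreeGroup.of 1) = g (FreeGroup.of 1)) :
    f = g := by
  apply FreeGroup.ext_hom
  intro i
  fin_cases i
  · exact h0
  · exact h1

instance {N G : Type*} [Group N] [Group G] [Finite N] [Finite G] (φ : G →* MulAut N) :
    Finite (N ⋊[φ] G) :=
  Finite.of_equiv _ SemidirectProduct.equivProd.symm

/-- The free profinite group of rank two is centerless: every finite quotient `Q` of the free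
group is dominated by a finite quotient whose center maps trivially to `Q`. -/
theorem exists_finite_quotient_center_le {Q : Type} [Group Q] [Finite Q]
    (q : FreeGroup (Fin 2) →* Q) :
    ∃ (R : Type) (_ : Group R) (_ : Finite R) (r : FreeGroup (Fin 2) →* R),
      ∀ g, Commute (r g) (r (FreeGroup.of 0)) → Commute (r g) (r (FreeGroup.of 1)) → q g = 1 := by
  have : NeZero (Nat.card Q) := ⟨Nat.card_pos.ne'⟩
  let Z := Multiplicative (ZMod (Nat.card Q))
  have : Finite Z := inferInstanceAs (Finite (ZMod (Nat.card Q)))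
  let c : Z := Multiplicative.ofAdd 1
  -- The exponent sums modulo |Q| control ⟨p a⟩ ∩ ⟨p b⟩: if p(a)^i = p(b)^j, then |Q| divides i, so
  -- q(a)^i = 1.
  let p : FreeGroup (Fin 2) →* Q × Z × Z := q.prod ((lift₂ c 1).prod (lift₂ 1 c))
  -- Marking a in `s` and b in `t` forces p(g) into ⟨p a⟩ and into ⟨p b⟩.
  let s := lift₂ (BinaryWreath.mark (p (FreeGroup.of 0))) (SemidirectProduct.inr (p (FreeGroup.of 1)))
  let t := lift₂ (SemidirectProduct.inr (p (FreeGroup.of 0))) (BinaryWreath.mark (p (FreeGroup.of 1)))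
  have hs : SemidirectProduct.rightHom.comp s = p :=
    freeGroup_hom_ext (by simp [s, BinaryWreath.mark]) (by simp [s])
  have ht : SemidirectProduct.rightHom.comp t = p :=
    freeGroup_hom_ext (by simp [t]) (by simp [t, BinaryWreath.mark])
  refine ⟨BinaryWreath (Q × Z × Z) × BinaryWreath (Q × Z × Z), inferInstance, inferInstance,
    s.prod t, fun g h0 h1 => ?_⟩
  have h0 : Commute (s g) (s (FreeGroup.of 0)) := congrArg Prod.fst h0.eq
  have h1 : Commute (t g) (t (FreeGroup.of 1)) := congrArg Prod.snd h1.eq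
  simp only [s, lift₂_of_zero] at h0
  simp only [t, lift₂_of_one] at h1
  replace h0 := BinaryWreath.right_mem_zpowers_of_commute h0
  replace h1 := BinaryWreath.right_mem_zpowers_of_commute h1
  rw [show (s g).right = p g from DFunLike.congr_fun hs g] at h0
  rw [show (t g).right = p g from DFunLike.congr_fun ht g] at h1
  obtain ⟨i, hi⟩ := h0
  obtain ⟨j, hj⟩ := h1
  have hij : p (FreeGroup.of 0) ^ i = p (FreeGroup.of 1) ^ j := hi.trans hj.symm
  have hc : c ^ i = 1 := by simpa [p] using congrArg (fun z => z.2.1) hij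
  have hdvd : (Nat.card Q : ℤ) ∣ i := by
    rw [← ZMod.intCast_zmod_eq_zero_iff_dvd]
    have h : i • (1 : ZMod (Nat.card Q)) = 0 := congrArg Multiplicative.toAdd hc
    simpa using h
  obtain ⟨m, rfl⟩ := hdvd
  have := congrArg Prod.fst hi
  simp only [p, Prod.pow_fst, MonoidHom.prod_apply] at this
  rw [← this, zpow_mul, zpow_natCast, pow_card_eq_one', one_zpow]

/-! ## An equivariant monomial representation -/

/-- The four-group. -/
abbrev FourGroup : Type := ℤˣ × ℤˣ

/-- The function on the four-group with given values at `(1, 1)`, `(-1, 1)`, `(1, -1)`,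
`(-1, -1)`. -/
def fourFun {G : Type*} (p q r s : G) : FourGroup → G := fun v =>
  if v.2 = 1 then if v.1 = 1 then p else q else if v.1 = 1 then r else s

theorem fourGroup_cases (v : FourGroup) :
    v = (1, 1) ∨ v = (-1, 1) ∨ v = (1, -1) ∨ v = (-1, -1) := by
  revert v; decide

/-- The monomial group of degree four over `G`, restricted to regular permutations. -/
abbrev Monomial (G : Type*) [Group G] : Type _ := (FourGroup → G) ⋊[mulAutArrow] FourGroup

/-- The representation of `F` induced from a homomorphism to the free group `Φ` of the kernel of
`F → FourGroup`. -/
def monomialRep : F₂ →* Monomial (FreeGroup (Fin 2)) :=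
  lift₂ ⟨fourFun 1 (FreeGroup.of 0)⁻¹ 1 (FreeGroup.of 0), (-1, 1)⟩
    ⟨fourFun 1 1 (FreeGroup.of 1)⁻¹ (FreeGroup.of 1), (1, -1)⟩

/-- The diagonal matrices by which `Φ` acts on `monomialRep`. -/
def diagonalRep : FreeGroup (Fin 2) →* (FourGroup → FreeGroup (Fin 2)) :=
  lift₂ (fourFun (FreeGroup.of 0) (FreeGroup.of 0) 1 1)
    (fourFun (FreeGroup.of 1) 1 (FreeGroup.of 1) 1)

theorem diagonalRep_apply_one (g : FreeGroup (Fin 2)) : diagonalRep g 1 = g :=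
  DFunLike.congr_fun (freeGroup_hom_ext (f := (Pi.evalMonoidHom _ 1).comp diagonalRep)
    (g := MonoidHom.id _) (by simp [diagonalRep, fourFun]) (by simp [diagonalRep, fourFun])) g

theorem mulAutArrow_four {G : Type*} [Group G] (u : FourGroup) (f : FourGroup → G)
    (v : FourGroup) : (mulAutArrow u : MulAut (FourGroup → G)) f v = f (u⁻¹ * v) := rfl

/-- The relation is stable under products and inverses in g, which leaves α and β on x and y. The
matrix of x commutes with the diagonal matrix of a, and the diagonal factor x² in α(y) is exactly
what conjugating y by that matrix produces; likewise for β. -/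
theorem monomialRep_ρ_comp (g : FreeGroup (Fin 2)) :
    monomialRep.comp (ρ g).toMonoidHom
      = (MulAut.conj (SemidirectProduct.inl (diagonalRep g))).toMonoidHom.comp monomialRep := by
  let P (g : FreeGroup (Fin 2)) : Prop := ∀ f, monomialRep (ρ g f)
    = SemidirectProduct.inl (diagonalRep g) * monomialRep f
      * (SemidirectProduct.inl (diagonalRep g))⁻¹
  have hmul {g h} (hg : P g) (hh : P h) : P (g * h) := fun f => by
    rw [map_mul, MulAut.mul_apply, hg, hh]
    simp [mul_assoc]
  have hinv {g} (hg : P g) : P g⁻¹ := fun f => by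
    have := hg ((ρ g)⁻¹ f)
    rw [MulAut.apply_inv_self] at this
    simp [this, mul_assoc]
  have hext {g : FreeGroup (Fin 2)} (hx : monomialRep (ρ g x)
      * SemidirectProduct.inl (diagonalRep g)
      = SemidirectProduct.inl (diagonalRep g) * monomialRep x)
      (hy : monomialRep (ρ g y) * SemidirectProduct.inl (diagonalRep g)
      = SemidirectProduct.inl (diagonalRep g) * monomialRep y) : P g := fun f =>
    DFunLike.congr_fun (freeGroup_hom_ext (f := monomialRep.comp (ρ g).toMonoidHom)
      (g := (MulAut.conj (SemidirectProduct.inl (diagonalRep g))).toMonoidHom.comp monomialRep)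
      (eq_mul_inv_of_mul_eq hx) (eq_mul_inv_of_mul_eq hy)) f
  have hof (i : Fin 2) : P (FreeGroup.of i) := by
    fin_cases i
    · apply hext
      all_goals
        simp only [ρ, FreeGroup.lift_apply_of, Matrix.cons_val_zero, α_x, α_y, Fin.zero_eta]
        simp only [map_mul, pow_two, monomialRep, x, y, diagonalRep, lift₂_of_zero,
          lift₂_of_one]
        ext v
        · rcases fourGroup_cases v with rfl | rfl | rfl | rfl <;>
            simp [mulAutArrow_four, fourFun, mul_assoc, -SemidirectProduct.mk_eq_inl_mul_inr,
              -mulAutArrow_apply_apply]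
        all_goals simp [-SemidirectProduct.mk_eq_inl_mul_inr]
    · apply hext
      all_goals
        simp only [ρ, FreeGroup.lift_apply_of, Matrix.cons_val_one, Matrix.cons_val_fin_one,
          β_x, β_y, Fin.mk_one]
        simp only [map_mul, pow_two, monomialRep, x, y, diagonalRep, lift₂_of_zero,
          lift₂_of_one]
        ext v
        · rcases fourGroup_cases v with rfl | rfl | rfl | rfl <;>
            simp [mulAutArrow_four, fourFun, mul_assoc, -SemidirectProduct.mk_eq_inl_mul_inr,
              -mulAutArrow_apply_apply]
        all_goals simp [-SemidirectProduct.mk_eq_inl_mul_inr]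
  have hP : P g := by
    induction g using FreeGroup.induction_on with
    | C1 => intro f; simp
    | of i => exact hof i
    | inv_of i h => exact hinv h
    | mul g h hg hh => exact hmul hg hh
  exact MonoidHom.ext hP

/-- The semidirect product of `F` and `Φ` with respect to `ρ`. -/
abbrev SemiProd : Type := F₂ ⋊[ρ] FreeGroup (Fin 2)

/-- The extension of `monomialRep` to the semidirect product. -/
def semiProdRep : SemiProd →* Monomial (FreeGroup (Fin 2)) :=
  SemidirectProduct.lift monomialRep (SemidirectProduct.inl.comp diagonalRep) monomialRep_ρ_comp

/-- The homomorphism between monomial groups induced by a homomorphism of coefficients. -/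
def Monomial.map {G H : Type*} [Group G] [Group H] (r : G →* H) : Monomial G →* Monomial H :=
  SemidirectProduct.map (r.compLeft FourGroup) (MonoidHom.id _) fun _ => rfl

/-- Comparing entries at the base point, commutation with x² and y² says that `r g` commutes with
the images of a and b in `R`, and `R` was chosen so that this forces q(g) = 1. -/
theorem exists_finite_quotient_centralizer_le {Q : Type} [Group Q] [Finite Q]
    (q : FreeGroup (Fin 2) →* Q) :
    ∃ (W : Type) (_ : Group W) (_ : Finite W) (w : SemiProd →* W),
      ∀ g, (∀ f, Commute (w (SemidirectProduct.inr g)) (w (SemidirectProduct.inl f))) →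
        q g = 1 := by
  obtain ⟨R, _, _, r, hr⟩ := exists_finite_quotient_center_le q
  refine ⟨Monomial R, inferInstance, inferInstance, (Monomial.map r).comp semiProdRep,
    fun g hg => ?_⟩
  have key (f : F₂) (h : FreeGroup (Fin 2)) (hright : (monomialRep f).right = 1)
      (hleft : (monomialRep f).left 1 = h⁻¹) : Commute (r g) (r h) := by
    have := congrFun (congrArg SemidirectProduct.left (hg f).eq) 1
    simp only [semiProdRep, MonoidHom.comp_apply, SemidirectProduct.lift_inl,
      SemidirectProduct.lift_inr] at this
    change r (diagonalRep g 1) * r ((monomialRep f).left (1⁻¹ * 1))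
      = r ((monomialRep f).left 1) * r (diagonalRep g ((monomialRep f).right⁻¹ * 1)) at this
    rw [hright, inv_one, mul_one, hleft, diagonalRep_apply_one, map_inv] at this
    exact Commute.inv_right_iff.mp this
  apply hr g
  · apply key (x ^ 2) <;>
      simp [monomialRep, x, pow_two, -SemidirectProduct.mk_eq_inl_mul_inr, mulAutArrow_four,
        -mulAutArrow_apply_apply, fourFun]
  · apply key (y ^ 2) <;>
      simp [monomialRep, y, pow_two, -SemidirectProduct.mk_eq_inl_mul_inr, mulAutArrow_four,
        -mulAutArrow_apply_apply, fourFun]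

/-! ## Finite quotients of profinite completions -/

section Completion

variable {G : Type u} [Group G]

theorem denseRange_toCompletion : DenseRange (toCompletion G) :=
  ProfiniteGrp.ProfiniteCompletion.denseRange (GrpCat.of G)

/-- The continuous homomorphism of profinite completions induced by a homomorphism. -/
def completionHom {H : Type u} [Group H] (f : G →* H) : Completion G →ₜ* Completion H :=
  (ProfiniteGrp.profiniteCompletion.map (GrpCat.ofHom f)).hom

theorem completionHom_toCompletion {H : Type u} [Group H] (f : G →* H) (g : G) :
    completionHom f (toCompletion G g) = toCompletion H (f g) :=
  ConcreteCategory.congr_hom (ProfiniteGrp.ProfiniteCompletion.lift_eta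
    (GrpCat.ofHom f ≫ ProfiniteGrp.ProfiniteCompletion.eta (GrpCat.of H))) g

/-- The kernel of a homomorphism to a finite group. -/
def finiteKer {Q : Type*} [Group Q] [Finite Q] (q : G →* Q) :
    FiniteIndexNormalSubgroup (GrpCat.of G) :=
  { toSubgroup := q.ker }

/-- The projection from the profinite completion to a finite quotient. -/
def completionProj (N : FiniteIndexNormalSubgroup (GrpCat.of G)) :
    Completion G →* G ⧸ N.toSubgroup where
  toFun z := z.1 N
  map_one' := rfl
  map_mul' _ _ := rfl

theorem isLocallyConstant_completionProj (N : FiniteIndexNormalSubgroup (GrpCat.of G)) :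
    IsLocallyConstant (completionProj N) := by
  let D := (ProfiniteGrp.ProfiniteCompletion.diagram (GrpCat.of G)).obj N
  have : DiscreteTopology D := ⟨rfl⟩
  have h : Continuous fun z : Completion G => (z.1 N : D) :=
    (continuous_apply N).comp continuous_subtype_val
  intro s
  have hs : IsOpen (X := D) s := isOpen_discrete (α := D) s
  exact hs.preimage h

/-- The extension to the profinite completion of a homomorphism to a finite group. -/
def finiteLift {Q : Type*} [Group Q] [Finite Q] (q : G →* Q) : Completion G →* Q :=
  (QuotientGroup.kerLift q).comp (completionProj (finiteKer q))

@[simp] theorem finiteLift_toCompletion {Q : Type*} [Group Q] [Finite Q] (q : G →* Q) (g : G) :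
    finiteLift q (toCompletion G g) = q g := rfl

theorem isLocallyConstant_finiteLift {Q : Type*} [Group Q] [Finite Q] (q : G →* Q) :
    IsLocallyConstant (finiteLift q) :=
  (isLocallyConstant_completionProj _).comp _

/-- Finite quotients separate the points of the profinite completion. -/
theorem exists_finiteLift_ne_one {z : Completion G} (hz : z ≠ 1) :
    ∃ (Q : Type u) (_ : Group Q) (_ : Finite Q) (q : G →* Q), finiteLift q z ≠ 1 := by
  obtain ⟨N, hN⟩ : ∃ N, z.1 N ≠ (1 : Completion G).1 N := by
    by_contra! h
    exact hz (Subtype.ext (funext h))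
  have : Finite (G ⧸ N.toSubgroup) := inferInstance
  refine ⟨G ⧸ N.toSubgroup, inferInstance, this, QuotientGroup.mk' N.toSubgroup, fun h => hN ?_⟩
  -- `finiteLift` reads the coordinate of z at the kernel of the quotient map, which must be
  -- identified with N.
  have hle : N = finiteKer (QuotientGroup.mk' N.toSubgroup) := by
    apply FiniteIndexNormalSubgroup.toSubgroup_injective
    exact (QuotientGroup.ker_mk' N.toSubgroup).symm
  have h1 : z.1 (finiteKer (QuotientGroup.mk' N.toSubgroup))
      = (1 : Completion G).1 (finiteKer (QuotientGroup.mk' N.toSubgroup)) :=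
    QuotientGroup.kerLift_injective _ h
  rwa [← hle] at h1

/-- Every element of the profinite completion agrees in a given finite quotient with an element of
the group. -/
theorem exists_finiteLift_eq {Q : Type*} [Group Q] [Finite Q] (q : G →* Q) (z : Completion G) :
    ∃ g : G, finiteLift q z = q g := by
  obtain ⟨_, h, g, rfl⟩ := mem_closure_iff.mp (denseRange_toCompletion z) _
    ((isLocallyConstant_finiteLift q).isOpen_fiber (finiteLift q z)) rfl
  exact ⟨g, h.symm⟩

theorem finiteLift_comp {H : Type u} [Group H] {Q : Type*} [Group Q] [Finite Q] (q : H →* Q)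
    (f : G →* H) (z : Completion G) :
    finiteLift q (completionHom f z) = finiteLift (q.comp f) z := by
  refine denseRange_toCompletion.induction_on (p := fun z =>
    finiteLift q (completionHom f z) = finiteLift (q.comp f) z) z ?_ fun g => ?_
  · let _ : TopologicalSpace Q := ⊥
    have : DiscreteTopology Q := ⟨rfl⟩
    exact isClosed_eq ((isLocallyConstant_finiteLift q).continuous.comp
      (completionHom f).continuous_toFun) (isLocallyConstant_finiteLift _).continuous
  · rw [completionHom_toCompletion]; rfl

theorem finiteLift_map {Q R : Type*} [Group Q] [Finite Q] [Group R] [Finite R] (m : Q →* R)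
    (q : G →* Q) (z : Completion G) : finiteLift (m.comp q) z = m (finiteLift q z) := by
  refine denseRange_toCompletion.induction_on (p := fun z =>
    finiteLift (m.comp q) z = m (finiteLift q z)) z ?_ fun g => rfl
  let _ : TopologicalSpace R := ⊥
  have : DiscreteTopology R := ⟨rfl⟩
  exact isClosed_eq (isLocallyConstant_finiteLift _).continuous
    ((isLocallyConstant_finiteLift q).comp m).continuous

/-- Simultaneous approximation in two finite quotients. -/
theorem exists_finiteLift_eq_and {Q R : Type*} [Group Q] [Finite Q] [Group R] [Finite R]
    (q : G →* Q) (r : G →* R) (z : Completion G) :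
    ∃ g : G, finiteLift q z = q g ∧ finiteLift r z = r g := by
  obtain ⟨g, hg⟩ := exists_finiteLift_eq (q.prod r) z
  refine ⟨g, ?_, ?_⟩
  · simpa [hg] using finiteLift_map (MonoidHom.fst Q R) (q.prod r) z
  · simpa [hg] using finiteLift_map (MonoidHom.snd Q R) (q.prod r) z

end Completion

/-! ## The profinite completion of the semidirect product -/

/-- The action of automorphisms on the homomorphisms to a fixed group. -/
def homPerm (G Q : Type*) [Group G] [Group Q] : MulAut G →* Equiv.Perm (G →* Q) where
  toFun e :=
    { toFun h := h.comp e⁻¹.toMonoidHom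
      invFun h := h.comp e.toMonoidHom
      left_inv h := by ext g; simp
      right_inv h := by ext g; simp }
  map_one' := rfl
  map_mul' _ _ := rfl

/-- A homomorphism from the semidirect product to a finite group, through which all
homomorphisms from `F` to `Q` factor. -/
def semiProdToFinite (Q : Type*) [Group Q] :
    SemiProd →* ((F₂ →* Q) → Q) ⋊[mulAutArrow] Equiv.Perm (F₂ →* Q) :=
  SemidirectProduct.map (MonoidHom.pi fun h => h) ((homPerm F₂ Q).comp ρ) fun g => by
    ext f h
    rfl

theorem finite_freeGroup_hom (Q : Type*) [Group Q] [Finite Q] : Finite (F₂ →* Q) :=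
  Finite.of_equiv _ FreeGroup.lift

/-- The map from the profinite completion of `F` to that of the semidirect product. -/
abbrev completionInl : Completion F₂ →ₜ* Completion SemiProd :=
  completionHom SemidirectProduct.inl

/-- The map from the profinite completion of `Φ` to that of the semidirect product. -/
abbrev completionInr : Completion (FreeGroup (Fin 2)) →ₜ* Completion SemiProd :=
  completionHom SemidirectProduct.inr

/-- A finite quotient q of F need not be Φ-invariant, but Φ permutes the finite set Hom(F, Q).
Taking all of it at once gives a finite quotient of F ⋊ Φ with q as one coordinate on F. -/
theorem completionInl_injective : Function.Injective completionInl := by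
  rw [injective_iff_map_eq_one]
  intro z hz
  by_contra hne
  obtain ⟨Q, _, _, q, hq⟩ := exists_finiteLift_ne_one hne
  have := finite_freeGroup_hom Q
  obtain ⟨f, hf, hf'⟩ := exists_finiteLift_eq_and q
    ((semiProdToFinite Q).comp SemidirectProduct.inl) z
  rw [← finiteLift_comp, hz, map_one] at hf'
  exact hq (hf.trans (congrFun (congrArg SemidirectProduct.left hf') q).symm)

theorem completionInl_isClosedEmbedding : Topology.IsClosedEmbedding completionInl :=
  completionInl.continuous_toFun.isClosedEmbedding completionInl_injective

theorem conj_completionInl (g : FreeGroup (Fin 2)) (z : Completion F₂) :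
    completionInr (toCompletion _ g) * completionInl z * (completionInr (toCompletion _ g))⁻¹
      = completionInl (completionAut F₂ (ρ g) z) := by
  refine denseRange_toCompletion.induction_on (p := fun z =>
    completionInr (toCompletion _ g) * completionInl z * (completionInr (toCompletion _ g))⁻¹
      = completionInl (completionAut F₂ (ρ g) z)) z ?_ fun f => ?_
  · refine isClosed_eq ?_ (completionInl.continuous_toFun.comp
      (completionAut F₂ (ρ g)).continuous_toFun)
    exact (continuous_const.mul completionInl.continuous_toFun).mul continuous_const
  · rw [completionAut_toCompletion]
    simp only [completionHom_toCompletion, SemidirectProduct.inl_aut, map_mul, map_inv]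

/-- True for k in the dense image of Φ, and a closed condition on k because the image of F̂ is
closed. -/
theorem exists_conj_completionInl (k : Completion (FreeGroup (Fin 2))) (z : Completion F₂) :
    ∃ z', completionInl z' = completionInr k * completionInl z * (completionInr k)⁻¹ := by
  refine denseRange_toCompletion.induction_on (p := fun k =>
    completionInr k * completionInl z * (completionInr k)⁻¹ ∈ Set.range completionInl) k ?_
    fun g => ⟨_, (conj_completionInl g z).symm⟩
  refine completionInl_isClosedEmbedding.isClosed_range.preimage ?_
  exact (completionInr.continuous_toFun.mul continuous_const).mul
    completionInr.continuous_toFun.inv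

/-! ### The action of Φ̂ on F̂ -/

/-- The action of the profinite completion of `Φ` on that of `F`, given by conjugation in the
profinite completion of the semidirect product. -/
def completionAct (k : Completion (FreeGroup (Fin 2))) (z : Completion F₂) : Completion F₂ :=
  (exists_conj_completionInl k z).choose

theorem completionInl_act (k : Completion (FreeGroup (Fin 2))) (z : Completion F₂) :
    completionInl (completionAct k z) = completionInr k * completionInl z * (completionInr k)⁻¹ :=
  (exists_conj_completionInl k z).choose_spec

theorem completionAct_mul_left (k l : Completion (FreeGroup (Fin 2))) (z : Completion F₂) :
    completionAct (k * l) z = completionAct k (completionAct l z) := by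
  apply completionInl_injective
  simp only [completionInl_act, map_mul, mul_inv_rev, mul_assoc]

theorem completionAct_one (z : Completion F₂) : completionAct 1 z = z := by
  apply completionInl_injective
  simp only [completionInl_act, map_one, inv_one, one_mul, mul_one]

theorem completionAct_mul_right (k : Completion (FreeGroup (Fin 2))) (z w : Completion F₂) :
    completionAct k (z * w) = completionAct k z * completionAct k w := by
  apply completionInl_injective
  simp only [completionInl_act, map_mul, mul_assoc, inv_mul_cancel_left]

/-- Continuity may be tested after the embedding of F̂, where the action is conjugation in a
topological group. -/
theorem continuous_completionAct : Continuous (Function.uncurry completionAct) := by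
  rw [completionInl_isClosedEmbedding.isInducing.continuous_iff]
  have hr := completionInr.continuous_toFun.comp
    (continuous_fst (X := Completion (FreeGroup (Fin 2))) (Y := Completion F₂))
  have hl := completionInl.continuous_toFun.comp
    (continuous_snd (X := Completion (FreeGroup (Fin 2))) (Y := Completion F₂))
  exact ((hr.mul hl).mul hr.inv).congr fun p => (completionInl_act p.1 p.2).symm

theorem continuous_completionAct_right (k : Completion (FreeGroup (Fin 2))) :
    Continuous (completionAct k) :=
  continuous_completionAct.uncurry_left k

/-- The continuous automorphism by which an element of the profinite completion of `Φ` acts. -/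
def completionActAut (k : Completion (FreeGroup (Fin 2))) : ContAut (Completion F₂) where
  toFun := completionAct k
  invFun := completionAct k⁻¹
  left_inv z := by rw [← completionAct_mul_left, inv_mul_cancel, completionAct_one]
  right_inv z := by rw [← completionAct_mul_left, mul_inv_cancel, completionAct_one]
  map_mul' := completionAct_mul_right k
  continuous_toFun := continuous_completionAct_right k
  continuous_invFun := continuous_completionAct_right k⁻¹

theorem continuous_completionActAut : Continuous completionActAut := by
  refine continuous_induced_rng.mpr (ContinuousMap.continuous_of_continuous_uncurry _ ?_)
  exact continuous_completionAct

/-- The homomorphism from the profinite completion of `Φ` to the continuous automorphisms of the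
profinite completion of `F`. -/
def completionActHom : Completion (FreeGroup (Fin 2)) →ₜ* ContAut (Completion F₂) where
  toFun := completionActAut
  map_one' := ContinuousMulEquiv.ext completionAct_one
  map_mul' k l := ContinuousMulEquiv.ext (completionAct_mul_left k l)
  continuous_toFun := continuous_completionActAut

theorem completionActHom_toCompletion (g : FreeGroup (Fin 2)) :
    completionActHom (toCompletion _ g) = completionAut F₂ (ρ g) :=
  ContinuousMulEquiv.ext fun z => completionInl_injective <|
    (completionInl_act _ z).trans (conj_completionInl g z)

theorem completionActHom_injective : Function.Injective completionActHom := by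
  rw [injective_iff_map_eq_one]
  intro k hk
  by_contra hne
  obtain ⟨Q, _, _, q, hq⟩ := exists_finiteLift_ne_one hne
  obtain ⟨W, _, _, w, hw⟩ := exists_finite_quotient_centralizer_le q
  -- A single g in Φ stands for k in both Q and `W`.
  obtain ⟨g, hg, hg'⟩ := exists_finiteLift_eq_and q (w.comp SemidirectProduct.inr) k
  rw [← finiteLift_comp] at hg'
  refine hq (hg.trans (hw g fun f => ?_))
  have h : completionAct k (toCompletion F₂ f) = toCompletion F₂ f := DFunLike.congr_fun hk _
  have h' := completionInl_act k (toCompletion F₂ f)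
  rw [h, eq_mul_inv_iff_mul_eq, completionHom_toCompletion] at h'
  have h'' := congrArg (finiteLift w) h'
  rw [map_mul, map_mul, hg', finiteLift_toCompletion] at h''
  exact h''.symm

/-- Needed for uniqueness: continuous maps into a Hausdorff space that agree on a dense set are
equal. -/
instance (G : Type u) [Group G] [TopologicalSpace G] [T2Space G] : T2Space (ContAut G) :=
  T2Space.of_injective_continuous (f := ContAut.toCMap)
    (fun _ _ h => ContinuousMulEquiv.ext fun z => DFunLike.congr_fun h z) continuous_induced_dom

end ProfAut
end

/-- The composite of `Φ → Aut F → Aut F̂` extends to exactly one continuous homomorphism `ν` from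
the profinite completion of `Φ` to `Aut F̂`, and this `ν` is injective. -/
theorem proposition3p3 :
    ∃ ν : ProfAut.Completion (FreeGroup (Fin 2)) →ₜ* ProfAut.ContAut (ProfAut.Completion ProfAut.F₂),
      (∀ g : FreeGroup (Fin 2),
        ν (ProfAut.toCompletion (FreeGroup (Fin 2)) g)
          = ProfAut.completionAut ProfAut.F₂ (ProfAut.ρ g)) ∧
      (∀ ν' : ProfAut.Completion (FreeGroup (Fin 2)) →ₜ*
            ProfAut.ContAut (ProfAut.Completion ProfAut.F₂),
        (∀ g : FreeGroup (Fin 2),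
          ν' (ProfAut.toCompletion (FreeGroup (Fin 2)) g)
            = ProfAut.completionAut ProfAut.F₂ (ProfAut.ρ g)) → ν' = ν) ∧
      Function.Injective ν := by
  refine ⟨ProfAut.completionActHom, ProfAut.completionActHom_toCompletion, fun ν' hν' => ?_,
    ProfAut.completionActHom_injective⟩
  refine DFunLike.coe_injective (ProfAut.denseRange_toCompletion.equalizer
    ν'.continuous_toFun ProfAut.completionActHom.continuous_toFun (funext fun g => ?_))
  exact (hν' g).trans (ProfAut.completionActHom_toCompletion g).symm
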